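/- For a permutation $\sigma=\sigma_1\cdots\sigma_N$ of $[N]=\{1,\dots,N\}$, a descent is a pair $(\sigma_i,\sigma_{i+1})$ with $1\le i<N$ and $\sigma_i>\sigma_{i+1}$; $\sigma_i$ is its descent top and $\sigma_{i+1}$ its descent bottom. Let - $\mathrm{des}\,\sigma$ be the number of descents of $\sigma$; - $\mathrm{lema}\,\sigma$ (resp. $\mathrm{loma}\,\sigma$) be the number of even (resp. odd) left-to-right maxima, i.e. values $\sigma_i$ with $\sigma_j<\sigma_i$ for all $j<i$; - $\mathrm{remi}\,\sigma$ (resp. $\mathrm{romi}\,\sigma$) be the number of even (resp. odd) right-to-left minima, i.e. values $\sigma_i$ with $\sigma_i<\sigma_j$ for all $j>i$; - $\mathrm{les}\,\sigma$ be the number of pairs $(i,j)$ with $2\le i<j\le N$ and $\sigma_{i-1}>\sigma_j>\sigma_i$; - $\mathrm{res}_{\downarrow}\,\sigma$ be the number of pairs $(i,j)$ with $1\le i<j\le N-1$ and $\sigma_j>\sigma_i>\sigma_{j+1}$; - $\mathrm{res}_{\uparrow}\,\sigma$ be the number of pairs $(i,j)$ with $1\le i<j\le N-1$ and $\sigma_{j+1}>\sigma_i>\sigma_j$;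 - $\mathrm{dd}\,\sigma$ be the number of double descents, i.e. indices $1\le i\le N$ with $\sigma_{i-1}>\sigma_i>\sigma_{i+1}$, where $\sigma_0=\sigma_{N+1}=0$; - $\mathrm{dom}\,\sigma$ (for $N=2n$) be the number of $j\in[n]$ such that $2j$ is a descent top and $2j-1$ is a descent bottom of $\sigma$ (not necessarily of the same descent). Let $\mathcal X_{2n}$ be the set of permutations of $[2n]$ all of whose descents have an even top and an odd bottom, and let $\mathcal Y^*_{2n+1}$ be the set of permutations of $[2n+1]$ all of whose descents have an odd top and an odd bottom and whose last entry is odd. Define $$X_n(a,\bar a,b,\bar b,p,q,y,t)=\sum_{\sigma\in\mathcal X_{2n}}a^{\mathrm{lema}\,\sigma}\,\bar a^{\mathrm{loma}\,\sigma}\,b^{\mathrm{romi}\,\sigma}\,\bar b^{\mathrm{remi}\,\sigma}\,p^{\mathrm{res}_{\downarrow}\sigma}\,q^{\mathrm{les}\,\sigma}\,y^{\mathrm{dom}\,\sigma}\,t^{\mathrm{des}\,\sigma},$$ $$Y_n(a,p,q,y,t)=\sum_{\sigma\in\mathcal Y^*_{2n+1}}a^{\mathrm{lema}\,\sigma}\,p^{\mathrm{res}_{\uparrow}\sigma}\,q^{\mathrm{les}\,\sigma}\,y^{\mathrm{dd}\,\sigma}\,t^{\mathrm{des}\,\sigma}.$$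 **Theorem.** For every $n\ge 1$, $$Y_n(a,p,q,y,t)=X_n(a,1,1,1,p,q,y,t)$$ as polynomials with integer coefficients; equivalently, for all elements $a,p,q,y,t$ of every commutative ring. -/

import Mathlib

namespace Genocchi

open Finset

/-- The one-line notation `σ₁ ⋯ σ_N` of a permutation of `[N] = {1, …, N}`: `entry σ k` is `σ_k`
for `1 ≤ k ≤ N`, and `entry σ k = 0` otherwise (so that `σ₀ = σ_{N+1} = 0`). -/
def entry {N : ℕ} (σ : Equiv.Perm (Fin N)) (k : ℕ) : ℕ :=
  if h : 1 ≤ k ∧ k ≤ N then (σ ⟨k - 1, by omega⟩ : ℕ) + 1 else 0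

/-- The position `i` (with `1 ≤ i < N`) carries a descent: `σ_i > σ_{i+1}`. -/
def IsDescentAt {N : ℕ} (σ : Equiv.Perm (Fin N)) (i : ℕ) : Prop :=
  i ∈ Ico 1 N ∧ entry σ i > entry σ (i + 1)

instance {N : ℕ} (σ : Equiv.Perm (Fin N)) (i : ℕ) : Decidable (IsDescentAt σ i) := by
  unfold IsDescentAt; infer_instance

/-- The number of descents. -/
def des {N : ℕ} (σ : Equiv.Perm (Fin N)) : ℕ :=
  #{i ∈ Ico 1 N | IsDescentAt σ i}

/-- The value `v` is a descent top. -/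
def IsDescentTop {N : ℕ} (σ : Equiv.Perm (Fin N)) (v : ℕ) : Prop :=
  ∃ i ∈ Ico 1 N, IsDescentAt σ i ∧ entry σ i = v

/-- The value `v` is a descent bottom. -/
def IsDescentBottom {N : ℕ} (σ : Equiv.Perm (Fin N)) (v : ℕ) : Prop :=
  ∃ i ∈ Ico 1 N, IsDescentAt σ i ∧ entry σ (i + 1) = v

instance {N : ℕ} (σ : Equiv.Perm (Fin N)) (v : ℕ) : Decidable (IsDescentTop σ v) := by
  unfold IsDescentTop; infer_instance

instance {N : ℕ} (σ : Equiv.Perm (Fin N)) (v : ℕ) : Decidable (IsDescentBottom σ v) := by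
  unfold IsDescentBottom; infer_instance

/-- `σ_i` is a left-to-right maximum. -/
def IsLeftToRightMax {N : ℕ} (σ : Equiv.Perm (Fin N)) (i : ℕ) : Prop :=
  ∀ j ∈ Ico 1 i, entry σ j < entry σ i

/-- `σ_i` is a right-to-left minimum. -/
def IsRightToLeftMin {N : ℕ} (σ : Equiv.Perm (Fin N)) (i : ℕ) : Prop :=
  ∀ j ∈ Ioc i N, entry σ i < entry σ j

instance {N : ℕ} (σ : Equiv.Perm (Fin N)) (i : ℕ) : Decidable (IsLeftToRightMax σ i) := by
  unfold IsLeftToRightMax; infer_instance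

instance {N : ℕ} (σ : Equiv.Perm (Fin N)) (i : ℕ) : Decidable (IsRightToLeftMin σ i) := by
  unfold IsRightToLeftMin; infer_instance

/-- The number of even left-to-right maxima. -/
def lema {N : ℕ} (σ : Equiv.Perm (Fin N)) : ℕ :=
  #{i ∈ Icc 1 N | IsLeftToRightMax σ i ∧ Even (entry σ i)}

/-- The number of odd left-to-right maxima. -/
def loma {N : ℕ} (σ : Equiv.Perm (Fin N)) : ℕ :=
  #{i ∈ Icc 1 N | IsLeftToRightMax σ i ∧ Odd (entry σ i)}

/-- The number of even right-to-left minima. -/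
def remi {N : ℕ} (σ : Equiv.Perm (Fin N)) : ℕ :=
  #{i ∈ Icc 1 N | IsRightToLeftMin σ i ∧ Even (entry σ i)}

/-- The number of odd right-to-left minima. -/
def romi {N : ℕ} (σ : Equiv.Perm (Fin N)) : ℕ :=
  #{i ∈ Icc 1 N | IsRightToLeftMin σ i ∧ Odd (entry σ i)}

/-- The number of pairs `(i, j)` with `2 ≤ i < j ≤ N` and `σ_{i-1} > σ_j > σ_i`. -/
def les {N : ℕ} (σ : Equiv.Perm (Fin N)) : ℕ :=
  #{x ∈ Icc 2 N ×ˢ Icc 2 N | x.1 < x.2 ∧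
    entry σ (x.1 - 1) > entry σ x.2 ∧ entry σ x.2 > entry σ x.1}

/-- The number of pairs `(i, j)` with `1 ≤ i < j ≤ N - 1` and `σ_j > σ_i > σ_{j+1}`:
the right embracings by descents, used for even-odd descent permutations. -/
def resDesc {N : ℕ} (σ : Equiv.Perm (Fin N)) : ℕ :=
  #{x ∈ Ico 1 N ×ˢ Ico 1 N | x.1 < x.2 ∧
    entry σ x.2 > entry σ x.1 ∧ entry σ x.1 > entry σ (x.2 + 1)}

/-- The number of pairs `(i, j)` with `1 ≤ i < j ≤ N - 1` and `σ_{j+1} > σ_i > σ_j`: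
the right embracings by ascents, used for odd-odd descent permutations. -/
def resAsc {N : ℕ} (σ : Equiv.Perm (Fin N)) : ℕ :=
  #{x ∈ Ico 1 N ×ˢ Ico 1 N | x.1 < x.2 ∧
    entry σ (x.2 + 1) > entry σ x.1 ∧ entry σ x.1 > entry σ x.2}

/-- The number of double descents `σ_{i-1} > σ_i > σ_{i+1}`, with `σ₀ = σ_{N+1} = 0`. -/
def dd {N : ℕ} (σ : Equiv.Perm (Fin N)) : ℕ :=
  #{i ∈ Icc 1 N | entry σ (i - 1) > entry σ i ∧ entry σ i > entry σ (i + 1)}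

/-- The number of dominos: indices `j ∈ [n]` such that `2j` is a descent top and `2j - 1` is a
descent bottom (not necessarily of the same descent). -/
def dom {n : ℕ} (σ : Equiv.Perm (Fin (2 * n))) : ℕ :=
  #{j ∈ Icc 1 n | IsDescentTop σ (2 * j) ∧ IsDescentBottom σ (2 * j - 1)}

/-- The even-odd descent permutations of `[2n]`: every descent has even top and odd bottom. -/
def evenOddPerms (n : ℕ) : Finset (Equiv.Perm (Fin (2 * n))) :=
  {σ | ∀ i ∈ Ico 1 (2 * n), IsDescentAt σ i → Even (entry σ i) ∧ Odd (entry σ (i + 1))}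

/-- The odd-odd descent permutations of `[2n+1]`: every descent has odd top and odd bottom. -/
def oddOddPerms (n : ℕ) : Finset (Equiv.Perm (Fin (2 * n + 1))) :=
  {σ | ∀ i ∈ Ico 1 (2 * n + 1), IsDescentAt σ i → Odd (entry σ i) ∧ Odd (entry σ (i + 1))}

/-- The odd-odd descent permutations of `[2n+1]` whose last entry is odd. -/
def oddOddPermsStar (n : ℕ) : Finset (Equiv.Perm (Fin (2 * n + 1))) :=
  {σ ∈ oddOddPerms n | Odd (entry σ (2 * n + 1))}

/-- The polynomial `X_n(a, a', b, b', p, q, y, t)`, with its variables in any commutative ring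
(in particular, they may be the indeterminates of a polynomial ring). -/
def polyX {R : Type*} [CommRing R] (n : ℕ) (a a' b b' p q y t : R) : R :=
  ∑ σ ∈ evenOddPerms n,
    a ^ lema σ * a' ^ loma σ * b ^ romi σ * b' ^ remi σ *
      p ^ resDesc σ * q ^ les σ * y ^ dom σ * t ^ des σ

/-- The polynomial `Y_n(a, p, q, y, t)`, with its variables in any commutative ring. -/
def polyY {R : Type*} [CommRing R] (n : ℕ) (a p q y t : R) : R :=
  ∑ σ ∈ oddOddPermsStar n,
    a ^ lema σ * p ^ resAsc σ * q ^ les σ * y ^ dd σ * t ^ des σ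

end Genocchi

/-!
A permutation of `[N]` arises by inserting the letters `1, …, N` in succession, each into one of the
gaps that will be filled by larger letters, the new letter leaving or not leaving a gap on either of
its sides. When `v` is inserted into a gap with `i` gaps to its left and `j` to its right, it is
already decided that in the final permutation `i` descents straddle `v` on its left, `j` ascents
straddle it on its right, and its neighbours are larger than `v` exactly on the sides where a gap
was left. Hence a sum over all permutations of products of weights that depend only on these data
satisfies a recursion in the number of gaps.

The polynomial `Y_n` is a sum of this kind. So is `X_n`, once `2n + 1` is appended to the
permutations of `[2n]`, which makes the straddling ascents on the right of a letter as many as the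
straddling descents, up to one. In both cases an odd letter inserted among `K` gaps and the even
letter after it lead, with the same weights, to `K - 1`, `K` or `K + 1` gaps: what an odd letter
closes on its right in `Y_n` is closed by the next even letter in `X_n`.
-/

namespace Genocchi

open Finset

section Profile

variable {α : Type*} [LinearOrder α]

/-- What a letter `u` sees of the word `s` on one of its sides, `s` being read away from `u`: the
number of ascents of `s` that straddle `u`, and whether `s` begins with a letter larger than `u`. -/
def profile (u : α) : List α → ℕ × Bool
  | [] => (0, false)
  | x :: s => ((profile u s).1 + if x < u ∧ (profile u s).2 then 1 else 0, decide (u < x))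

/-- The part of a word after the first occurrence of `u`, empty if `u` does not occur. -/
def suffixAfter (u : α) (w : List α) : List α := (w.dropWhile (· ≠ u)).tail

/-- The profile of `u` on its right in the word `w`. -/
def rightProfile (u : α) (w : List α) : ℕ × Bool := profile u (suffixAfter u w)

/-- The profile of `u` on its left in the word `w`: as the left side is read backwards, its first
component counts the descents of `w` that straddle `u`. -/
def leftProfile (u : α) (w : List α) : ℕ × Bool := rightProfile u w.reverse

variable {u : α} {B B' l r s s' : List α}

theorem profile_append_congr (h : profile u s = profile u s') (l : List α) :
    profile u (l ++ s) = profile u (l ++ s') := by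
  induction l with
  | nil => exact h
  | cons x l ih => simp only [List.cons_append, profile, ih]

theorem profile_append_of_forall_lt (hB : B ≠ []) (h : ∀ x ∈ B, u < x) (r : List α) :
    profile u (B ++ r) = ((profile u r).1, true) := by
  induction B with
  | nil => exact absurd rfl hB
  | cons x B ih =>
    have hx : u < x := h x (by simp)
    have hB : (profile u (B ++ r)).1 = (profile u r).1 := by
      rcases eq_or_ne B [] with rfl | hne
      · rfl
      · rw [ih hne fun y hy => h y (by simp [hy])]
    simp [profile, hx, hx.not_gt, hB]

theorem suffixAfter_append_cons (h : u ∉ l) (r : List α) : suffixAfter u (l ++ u :: r) = r := by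
  rw [suffixAfter, List.dropWhile_append_of_pos (by grind)]
  simp

theorem suffixAfter_of_notMem (h : u ∉ l) : suffixAfter u l = [] := by
  rw [suffixAfter, List.dropWhile_eq_nil_iff.2 (by grind), List.tail_nil]

theorem suffixAfter_append_of_notMem (h : u ∉ l) (r : List α) :
    suffixAfter u (l ++ r) = suffixAfter u r := by
  rw [suffixAfter, List.dropWhile_append_of_pos (by grind), suffixAfter]

theorem suffixAfter_append_of_mem (h : u ∈ l) (r : List α) :
    suffixAfter u (l ++ r) = suffixAfter u l ++ r := by
  induction l with
  | nil => simp at h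
  | cons x l ih => grind [suffixAfter, List.dropWhile_cons]

theorem rightProfile_replace (hB : B ≠ []) (hB' : B' ≠ []) (h : ∀ x ∈ B, u < x)
    (h' : ∀ x ∈ B', u < x) (l r : List α) :
    rightProfile u (l ++ B ++ r) = rightProfile u (l ++ B' ++ r) := by
  have hu : u ∉ B := fun hu => (h u hu).false
  have hu' : u ∉ B' := fun hu => (h' u hu).false
  have hBr : profile u (B ++ r) = profile u (B' ++ r) := by
    rw [profile_append_of_forall_lt hB h, profile_append_of_forall_lt hB' h']
  simp only [rightProfile, List.append_assoc]
  by_cases hl : u ∈ l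
  · rw [suffixAfter_append_of_mem hl, suffixAfter_append_of_mem hl, profile_append_congr hBr]
  · simp only [suffixAfter_append_of_notMem hl, suffixAfter_append_of_notMem hu,
      suffixAfter_append_of_notMem hu']

end Profile

section GapWord

/-- Two letters are not both the placeholder `M`. -/
def NotBoth (M x y : ℕ) : Prop := ¬(x = M ∧ y = M)

/-- The optional placeholder. -/
def pad (M : ℕ) (b : Bool) : List ℕ := if b then [M] else []

/-- The nonempty words in the letters `1, …, v`, each occurring once, and placeholders `M`, no two
of them adjacent. A placeholder stands for a gap, a nonempty word in larger letters. -/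
def IsGapWord (M v : ℕ) (w : List ℕ) : Prop :=
  w.IsChain (NotBoth M) ∧ (w.filter (· ≠ M)).Perm (List.range' 1 v) ∧ w ≠ []

/-- The ways to single out a gap of a word: the pairs `(l, r)` such that the word is
`l.reverse ++ M :: r`. The left part is read away from the gap, like the right part. -/
def zippers (M : ℕ) : List ℕ → Finset (List ℕ × List ℕ)
  | [] => ∅
  | x :: w => (if x = M then {([], w)} else ∅) ∪ (zippers M w).image fun z => (z.1 ++ [x], z.2)

/-- The insertion of the letter `v` in the gap singled out by `z`; the Booleans tell whether a gap
remains on the left and on the right of `v`. -/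
def insertLetter (M v : ℕ) (z : List ℕ × List ℕ) (b c : Bool) : List ℕ :=
  (pad M b ++ z.1).reverse ++ v :: (pad M c ++ z.2)

/-- The words obtained from the single gap by inserting successively the letters `1, …, v`. -/
def gapWords (M : ℕ) : ℕ → Finset (List ℕ)
  | 0 => {[M]}
  | v + 1 => (((gapWords M v).biUnion (zippers M)) ×ˢ univ).image fun (z, b, c) =>
      insertLetter M (v + 1) z b c

variable {M v : ℕ} {l r s w : List ℕ} {z z' : List ℕ × List ℕ} {b b' c c' : Bool}

theorem mem_zippers : z ∈ zippers M w ↔ w = z.1.reverse ++ M :: z.2 := by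
  induction w generalizing z with
  | nil => simp [zippers]
  | cons x w ih =>
    obtain ⟨l, r⟩ := z
    rcases List.eq_nil_or_concat l with rfl | ⟨l, y, rfl⟩
    · by_cases hx : x = M <;> simp [zippers, hx, eq_comm (a := r)]
    · by_cases hx : x = M <;> simp [zippers, hx, ih, and_comm]

theorem sum_zippers {R : Type*} [AddCommMonoid R] (w : List ℕ) (g : ℕ → ℕ → R) :
    ∑ z ∈ zippers M w, g (z.1.count M) (z.2.count M) =
      ∑ i ∈ range (w.count M), g i (w.count M - 1 - i) := by
  induction w generalizing g with
  | nil => simp [zippers]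
  | cons x w ih =>
    have hinj : Function.Injective fun z : List ℕ × List ℕ => (z.1 ++ [x], z.2) := by
      rintro ⟨l, r⟩ ⟨l', r'⟩ h
      simpa using h
    by_cases hx : x = M
    · subst hx
      rw [zippers, sum_union (by simp), sum_image hinj.injOn]
      simp only [List.count_append, ↓reduceIte, sum_singleton,
        List.count_nil, ih fun i j => g (i + 1) j, List.count_cons_self, sum_range_succ']
      rw [add_comm]
      exact congrArg₂ _ (sum_congr rfl fun i _ => by congr 1; omega) rfl
    · simpa [zippers, hx, sum_image hinj.injOn, List.count_cons] using ih g

theorem isChain_reverse_append_cons {x : ℕ} :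
    (l.reverse ++ x :: r).IsChain (NotBoth M) ↔
      (x :: l).IsChain (NotBoth M) ∧ (x :: r).IsChain (NotBoth M) := by
  have hflip : (fun x y => NotBoth M y x) = NotBoth M := by
    ext x y
    simp only [NotBoth, and_comm]
  rw [List.isChain_split, ← List.reverse_cons, List.isChain_reverse, hflip]

theorem isGapWord_gap_iff :
    IsGapWord M v (l.reverse ++ M :: r) ↔ (M :: l).IsChain (NotBoth M) ∧
      (M :: r).IsChain (NotBoth M) ∧ ((l ++ r).filter (· ≠ M)).Perm (List.range' 1 v) := by
  have hperm : ((l.reverse ++ M :: r).filter (· ≠ M)).Perm ((l ++ r).filter (· ≠ M)) := by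
    simpa using (List.perm_middle.trans ((l.reverse_perm.append_right r).cons M)).filter (· ≠ M)
  simp only [IsGapWord, isChain_reverse_append_cons, hperm.congr_left, and_assoc]
  simp

theorem isGapWord_insertLetter_iff (hv : v + 1 ≠ M) :
    IsGapWord M (v + 1) (insertLetter M (v + 1) z b c) ↔
      (pad M b ++ z.1).IsChain (NotBoth M) ∧ (pad M c ++ z.2).IsChain (NotBoth M) ∧
        ((z.1 ++ z.2).filter (· ≠ M)).Perm (List.range' 1 v) := by
  have hcons (s : List ℕ) : ((v + 1) :: s).IsChain (NotBoth M) ↔ s.IsChain (NotBoth M) :=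
    List.isChain_cons.trans (and_iff_right fun _ _ h => hv h.1)
  have hperm : ((insertLetter M (v + 1) z b c).filter (· ≠ M)).Perm
      ((v + 1) :: (z.1 ++ z.2).filter (· ≠ M)) := by
    have := (List.perm_middle.trans (((pad M b ++ z.1).reverse_perm.append_right
      (pad M c ++ z.2)).cons (v + 1))).filter (· ≠ M)
    cases b <;> cases c <;> simpa [insertLetter, pad, hv] using this
  have hrange : (List.range' 1 (v + 1)).Perm ((v + 1) :: List.range' 1 v) := by
    rw [List.range'_concat, one_mul, add_comm]
    exact List.perm_append_singleton _ _
  simp only [IsGapWord, insertLetter, isChain_reverse_append_cons, hcons, and_assoc]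
  rw [← insertLetter, hperm.congr_left, hrange.congr_right, List.perm_cons]
  simp [insertLetter]

theorem exists_eq_pad_append (h : s.IsChain (NotBoth M)) :
    ∃ c r, s = pad M c ++ r ∧ (M :: r).IsChain (NotBoth M) := by
  by_cases hs : s.head? = some M
  · obtain ⟨r, rfl⟩ := List.head?_eq_some_iff.1 hs
    exact ⟨true, r, rfl, h⟩
  · exact ⟨false, s, rfl, List.isChain_cons.2 ⟨fun x hx h => hs (h.2 ▸ hx), h⟩⟩

theorem isChain_pad_append (h : (M :: r).IsChain (NotBoth M)) :
    (pad M c ++ r).IsChain (NotBoth M) := by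
  cases c
  · exact h.tail
  · exact h

theorem pad_append_inj (hl : (M :: l).IsChain (NotBoth M)) (hr : (M :: r).IsChain (NotBoth M))
    (h : pad M b ++ l = pad M c ++ r) : b = c ∧ l = r := by
  have hM (s : List ℕ) : ¬ (M :: M :: s).IsChain (NotBoth M) := fun h =>
    (List.isChain_cons_cons.1 h).1 ⟨rfl, rfl⟩
  cases b <;> cases c <;> simp only [pad, Bool.false_eq_true, ↓reduceIte, List.nil_append,
    List.cons_append, List.cons.injEq, true_and] at h
  · exact ⟨rfl, h⟩
  · exact (hM r (h ▸ hl)).elim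
  · exact (hM l (h ▸ hr)).elim
  · exact ⟨rfl, h⟩

theorem IsGapWord.le_or_eq (h : IsGapWord M v w) {x : ℕ} (hx : x ∈ w) : x ≤ v ∨ x = M := by
  refine or_iff_not_imp_right.2 fun hM => ?_
  have : x ∈ List.range' 1 v := h.2.1.mem_iff.1 (by simp [hx, hM])
  rw [List.mem_range'_1] at this
  omega

theorem IsGapWord.exists_insertLetter (hv : v + 1 ≠ M) (h : IsGapWord M (v + 1) w) :
    ∃ z b c, IsGapWord M v (z.1.reverse ++ M :: z.2) ∧ insertLetter M (v + 1) z b c = w := by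
  have hmem : v + 1 ∈ w.filter (· ≠ M) := h.2.1.mem_iff.2 (List.mem_range'_1.2 (by omega))
  obtain ⟨l, r, rfl⟩ := List.append_of_mem (List.mem_of_mem_filter hmem)
  obtain ⟨s, rfl⟩ : ∃ s : List ℕ, s.reverse = l := ⟨l.reverse, l.reverse_reverse⟩
  obtain ⟨hs, hr⟩ := isChain_reverse_append_cons.1 h.1
  obtain ⟨b, l, rfl, hl⟩ := exists_eq_pad_append hs.tail
  obtain ⟨c, r, rfl, hr'⟩ := exists_eq_pad_append hr.tail
  have hperm := ((isGapWord_insertLetter_iff (z := (l, r)) hv).1 h).2.2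
  exact ⟨(l, r), b, c, isGapWord_gap_iff.2 ⟨hl, hr', hperm⟩, rfl⟩

theorem mem_gapWords (hv : v < M) : w ∈ gapWords M v ↔ IsGapWord M v w := by
  induction v generalizing w with
  | zero =>
    simp only [gapWords, mem_singleton, IsGapWord, List.range'_zero, List.perm_nil]
    refine ⟨by rintro rfl; simp, fun ⟨hchain, hfilter, hne⟩ => ?_⟩
    match w, hne with
    | [x], _ => simpa using hfilter
    | x :: y :: w, _ =>
      have : x = M ∧ y = M := by grind
      exact absurd this (List.isChain_cons_cons.1 hchain).1
  | succ v ih =>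
    simp only [gapWords, mem_image, mem_product, mem_biUnion, mem_zippers, ih (by omega : v < M)]
    constructor
    · rintro ⟨⟨z, b, c⟩, ⟨⟨w', hw', rfl⟩, -⟩, rfl⟩
      obtain ⟨hl, hr, hperm⟩ := isGapWord_gap_iff.1 hw'
      exact (isGapWord_insertLetter_iff hv.ne).2
        ⟨isChain_pad_append hl, isChain_pad_append hr, hperm⟩
    · intro h
      obtain ⟨z, b, c, hz, rfl⟩ := h.exists_insertLetter hv.ne
      exact ⟨(z, b, c), ⟨⟨_, hz, rfl⟩, mem_univ _⟩, rfl⟩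

/-- A gap singled out in a word in which the letter `v` may be inserted. -/
structure IsGapAt (M v : ℕ) (z : List ℕ × List ℕ) : Prop where
  isChain_left : (M :: z.1).IsChain (NotBoth M)
  isChain_right : (M :: z.2).IsChain (NotBoth M)
  lt_or_eq_left : ∀ x ∈ z.1, x < v ∨ x = M
  lt_or_eq_right : ∀ x ∈ z.2, x < v ∨ x = M

theorem IsGapAt.notMem_pad_left (hv : v < M) (hz : IsGapAt M v z) : v ∉ pad M b ++ z.1 := by
  have : v ∉ z.1 := fun h => (hz.lt_or_eq_left v h).elim (lt_irrefl v) hv.ne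
  cases b <;> simp [pad, this, hv.ne]

theorem IsGapAt.notMem_pad_right (hv : v < M) (hz : IsGapAt M v z) : v ∉ pad M c ++ z.2 := by
  have : v ∉ z.2 := fun h => (hz.lt_or_eq_right v h).elim (lt_irrefl v) hv.ne
  cases c <;> simp [pad, this, hv.ne]

theorem insertLetter_inj (hv : v < M) (hz : IsGapAt M v z) (hz' : IsGapAt M v z')
    (h : insertLetter M v z b c = insertLetter M v z' b' c') : z = z' ∧ b = b' ∧ c = c' := by
  rw [insertLetter, insertLetter, List.append_cons_inj_of_notMem
    (by simpa only [List.mem_reverse] using hz.notMem_pad_left hv) (hz.notMem_pad_right hv),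
    List.reverse_inj] at h
  obtain ⟨rfl, hl⟩ := pad_append_inj hz.isChain_left hz'.isChain_left h.1
  obtain ⟨rfl, hr⟩ := pad_append_inj hz.isChain_right hz'.isChain_right h.2.2
  exact ⟨Prod.ext hl hr, rfl, rfl⟩

theorem isGapAt_of_mem_zippers (hv : v < M) (hw : w ∈ gapWords M v) (hz : z ∈ zippers M w) :
    IsGapAt M (v + 1) z := by
  rw [mem_gapWords hv] at hw
  obtain rfl := mem_zippers.1 hz
  obtain ⟨hl, hr, -⟩ := isGapWord_gap_iff.1 hw
  refine ⟨hl, hr, fun x hx => ?_, fun x hx => ?_⟩ <;>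
    exact (hw.le_or_eq (by simp [hx])).imp_left Nat.lt_succ_of_le

theorem sum_gapWords_succ {R : Type*} [AddCommMonoid R] (hv : v + 1 < M) (F : List ℕ → R) :
    ∑ w ∈ gapWords M (v + 1), F w = ∑ w ∈ gapWords M v, ∑ z ∈ zippers M w,
      ∑ b, ∑ c, F (insertLetter M (v + 1) z b c) := by
  rw [gapWords, sum_image, sum_product, sum_biUnion]
  · simp only [Fintype.sum_prod_type]
  · intro w _ w' _ hne
    exact disjoint_left.2 fun z hz hz' => hne ((mem_zippers.1 hz).trans (mem_zippers.1 hz').symm)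
  · rintro ⟨z, b, c⟩ h ⟨z', b', c'⟩ h' heq
    simp only [coe_product, Set.mem_prod, mem_coe, mem_biUnion] at h h'
    obtain ⟨⟨w, hw, hz⟩, -⟩ := h
    obtain ⟨⟨w', hw', hz'⟩, -⟩ := h'
    have hv' : v < M := by omega
    obtain ⟨rfl, rfl, rfl⟩ := insertLetter_inj hv (isGapAt_of_mem_zippers hv' hw hz)
      (isGapAt_of_mem_zippers hv' hw' hz') heq
    rfl

end GapWord

section Transfer

variable {M v : ℕ} {r : List ℕ} {z : List ℕ × List ℕ} {b c : Bool}

theorem profile_cons_of_isChain {x : ℕ} (hv : v < M) (hchain : (x :: r).IsChain (NotBoth M))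
    (hlt : ∀ y ∈ x :: r, y < v ∨ y = M) : profile v (x :: r) = (r.count M, decide (x = M)) := by
  have hx (x : ℕ) (hx : x < v ∨ x = M) : v < x ↔ x = M := by omega
  induction r generalizing x with
  | nil => simp [profile, hx x (hlt x (by simp))]
  | cons y r ih =>
    obtain ⟨hxy, hchain⟩ := List.isChain_cons_cons.1 hchain
    have hlt_x := hlt x (by simp)
    have hgap : x < v ∧ y = M ↔ y = M :=
      and_iff_right_of_imp fun hy => hlt_x.resolve_right fun hx => hxy ⟨hx, hy⟩
    rw [profile, ih hchain fun z hz => hlt z (by simp [hz])]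
    simp only [decide_eq_true_eq, hgap, List.count_cons, beq_iff_eq, hx x hlt_x]

theorem IsGapAt.profile_right (hv : v < M) (hz : IsGapAt M v z) :
    profile v (pad M c ++ z.2) = (z.2.count M, c) := by
  obtain ⟨l, r⟩ := z
  obtain ⟨-, hchain, -, hlt⟩ := hz
  cases c with
  | true => simpa [pad] using profile_cons_of_isChain hv hchain (by simpa using hlt)
  | false =>
    match r with
    | [] => rfl
    | x :: r =>
      have hx : x ≠ M := fun hx => (List.isChain_cons_cons.1 hchain).1 ⟨rfl, hx⟩
      simpa [pad, hx] using profile_cons_of_isChain hv hchain.tail hlt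

theorem IsGapAt.rightProfile_insertLetter (hv : v < M) (hz : IsGapAt M v z) :
    rightProfile v (insertLetter M v z b c) = (z.2.count M, c) := by
  rw [rightProfile, insertLetter,
    suffixAfter_append_cons (by simpa only [List.mem_reverse] using hz.notMem_pad_left hv),
    hz.profile_right hv]

theorem IsGapAt.swap (hz : IsGapAt M v z) : IsGapAt M v z.swap :=
  ⟨hz.isChain_right, hz.isChain_left, hz.lt_or_eq_right, hz.lt_or_eq_left⟩

theorem reverse_insertLetter :
    (insertLetter M v z b c).reverse = insertLetter M v z.swap c b := by
  simp [insertLetter]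

theorem IsGapAt.leftProfile_insertLetter (hv : v < M) (hz : IsGapAt M v z) :
    leftProfile v (insertLetter M v z b c) = (z.1.count M, b) := by
  rw [leftProfile, reverse_insertLetter, hz.swap.rightProfile_insertLetter hv, Prod.snd_swap]

theorem rightProfile_insertLetter_of_lt {u : ℕ} (hu : u < v) (hv : v < M) :
    rightProfile u (insertLetter M v z b c) = rightProfile u (z.1.reverse ++ M :: z.2) := by
  have := rightProfile_replace (u := u) (B := pad M b ++ v :: pad M c) (B' := [M]) (by simp)
    (by simp) (by cases b <;> cases c <;> simp [pad] <;> omega) (by simp; omega) z.1.reverse z.2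
  cases b <;> simpa [insertLetter, pad] using this

theorem leftProfile_insertLetter_of_lt {u : ℕ} (hu : u < v) (hv : v < M) :
    leftProfile u (insertLetter M v z b c) = leftProfile u (z.1.reverse ++ M :: z.2) := by
  rw [leftProfile, reverse_insertLetter, rightProfile_insertLetter_of_lt hu hv, leftProfile]
  simp

theorem count_insertLetter (hv : v ≠ M) :
    (insertLetter M v z b c).count M = z.1.count M + z.2.count M + b.toNat + c.toNat := by
  cases b <;> cases c <;> simp [insertLetter, pad, hv] <;> omega

variable {R : Type*} [CommSemiring R] (f : ℕ → Bool → ℕ × Bool → ℕ × Bool → R)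

/-- The weight of the letter `u` in a word: `f` is applied to `u`, to whether `u - 1` is preceded by
a larger letter, and to the left and right profiles of `u`. -/
def letterWeight (u : ℕ) (w : List ℕ) : R :=
  f u (leftProfile (u - 1) w).2 (leftProfile u w) (rightProfile u w)

/-- The total weight of the ways to insert the letters `v + 1, …, v + m` in a word with `K` gaps so
that no gap remains, `d` telling whether `v` is preceded by a larger letter. -/
def transfer : ℕ → ℕ → Bool → ℕ → R
  | 0, _, _, K => if K = 0 then 1 else 0
  | m + 1, v, d, K => ∑ i ∈ range K, ∑ b, ∑ c : Bool,
      f (v + 1) d (i, b) (K - 1 - i, c) * transfer m (v + 1) b (K - 1 + b.toNat + c.toNat)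

theorem IsGapAt.prod_letterWeight_insertLetter (hv : v + 1 < M) (hz : IsGapAt M (v + 1) z) :
    ∏ u ∈ Icc 1 (v + 1), letterWeight f u (insertLetter M (v + 1) z b c) =
      (∏ u ∈ Icc 1 v, letterWeight f u (z.1.reverse ++ M :: z.2)) *
        f (v + 1) (leftProfile v (z.1.reverse ++ M :: z.2)).2 (z.1.count M, b)
          (z.2.count M, c) := by
  rw [prod_Icc_succ_top (by omega)]
  congr 1
  · refine prod_congr rfl fun u hu => ?_
    have hu : u < v + 1 := by grind
    rw [letterWeight, letterWeight, rightProfile_insertLetter_of_lt hu hv,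
      leftProfile_insertLetter_of_lt hu hv, leftProfile_insertLetter_of_lt (by omega) hv]
  · rw [letterWeight, hz.leftProfile_insertLetter hv, hz.rightProfile_insertLetter hv,
      Nat.add_sub_cancel, leftProfile_insertLetter_of_lt v.lt_succ_self hv]

theorem sum_gapWords_mul_transfer (m : ℕ) (hv : v < M) :
    ∑ w ∈ gapWords M v, (∏ u ∈ Icc 1 v, letterWeight f u w) *
      transfer f m v (leftProfile v w).2 (w.count M) = transfer f (v + m) 0 false 1 := by
  induction v generalizing m with
  | zero =>
    have : leftProfile 0 [M] = (0, false) := by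
      rw [leftProfile, rightProfile, suffixAfter_of_notMem (by simp; omega), profile]
    simp [gapWords, this]
  | succ v ih =>
    rw [add_assoc, add_comm 1 m, ← ih (m + 1) (by omega), sum_gapWords_succ hv]
    refine sum_congr rfl fun w hw => ?_
    rw [transfer, ← sum_zippers w fun i j => ∑ b, ∑ c, f (v + 1) (leftProfile v w).2 (i, b) (j, c) *
      transfer f m (v + 1) b (w.count M - 1 + b.toNat + c.toNat), mul_sum]
    refine sum_congr rfl fun z hz => ?_
    have hgap := isGapAt_of_mem_zippers (by omega) hw hz
    have hcount : w.count M - 1 = z.1.count M + z.2.count M := by simp [mem_zippers.1 hz]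
    simp only [mul_sum, hgap.prod_letterWeight_insertLetter f hv, hgap.leftProfile_insertLetter hv,
      count_insertLetter hv.ne, ← mem_zippers.1 hz, hcount, mul_assoc]

theorem filter_count_gapWords {N : ℕ} (hN : 0 < N) :
    {w ∈ gapWords (N + 1) N | w.count (N + 1) = 0} =
      (List.range' 1 N).permutations.toFinset := by
  ext w
  simp only [mem_filter, mem_gapWords N.lt_succ_self, List.count_eq_zero, List.mem_toFinset,
    List.mem_permutations]
  constructor
  · rintro ⟨h, hM⟩
    have := h.2.1
    rwa [List.filter_eq_self.2 (by grind)] at this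
  · intro h
    have hM : N + 1 ∉ w := by simp [h.mem_iff, List.mem_range'_1, add_comm]
    refine ⟨⟨?_, ?_, ?_⟩, hM⟩
    · exact (List.isChain_isInfix w).imp fun x y hxy hb => hM (hxy.subset (by simp [hb.1]))
    · rwa [List.filter_eq_self.2 (by grind)]
    · rintro rfl
      exact absurd h.length_eq (by simpa using hN.ne)

theorem sum_permutations_prod_letterWeight {N : ℕ} (hN : 0 < N) :
    ∑ w ∈ (List.range' 1 N).permutations.toFinset, ∏ u ∈ Icc 1 N, letterWeight f u w =
      transfer f N 0 false 1 := by
  have := sum_gapWords_mul_transfer f 0 N.lt_succ_self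
  simpa only [← filter_count_gapWords hN, sum_filter, transfer, mul_ite, mul_one, mul_zero,
    add_zero] using this

end Transfer

section PositionalStatistics

theorem profile_map_range' {e : ℕ → ℕ} {u s m : ℕ} (he : e (s + m) ≤ u) :
    profile u ((List.range' s m).map e) =
      (#{j ∈ Ico s (s + m) | e j < u ∧ u < e (j + 1)}, decide (u < e s)) := by
  induction m generalizing s with
  | zero => simpa [profile] using he
  | succ m ih =>
    rw [List.range'_succ, List.map_cons, profile, ih (by rwa [add_assoc, add_comm 1])]
    have : s ∉ {j ∈ Ico (s + 1) (s + (m + 1)) | e j < u ∧ u < e (j + 1)} := by simp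
    rw [add_assoc, add_comm 1 m, ← insert_Ico_add_one_left_eq_Ico (by omega : s < s + (m + 1)),
      filter_insert, apply_ite card, card_insert_of_notMem this]
    simp only [decide_eq_true_eq]
    split_ifs <;> rfl

theorem profile_reverse_map_range' {e : ℕ → ℕ} {u : ℕ} (he : e 0 ≤ u) (m : ℕ) :
    profile u ((List.range' 1 m).map e).reverse =
      (#{i ∈ range m | e (i + 1) < u ∧ u < e i}, decide (u < e m)) := by
  induction m with
  | zero => simpa [profile] using he
  | succ m ih =>
    rw [List.range'_concat, List.map_append, List.reverse_append, List.map_singleton,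
      List.reverse_singleton, List.singleton_append, profile, ih, range_add_one, filter_insert,
      apply_ite card, card_insert_of_notMem (by simp)]
    simp only [decide_eq_true_eq, one_mul, add_comm 1 m]
    split_ifs <;> rfl

variable {N : ℕ} (σ : Equiv.Perm (Fin N))

@[simp]
theorem entry_zero : entry σ 0 = 0 := by simp [entry]

theorem entry_of_lt {k : ℕ} (hk : N < k) : entry σ k = 0 := dif_neg (by omega)

@[simp]
theorem entry_add_one (i : Fin N) : entry σ (i + 1) = σ i + 1 := by simp [entry]

theorem bijOn_entry : Set.BijOn (entry σ) (Icc 1 N) (Icc 1 N) := by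
  have hFin {k : ℕ} (hk : k ∈ Icc 1 N) : ∃ i : Fin N, k = i + 1 := by
    rw [mem_Icc] at hk
    exact ⟨⟨k - 1, by omega⟩, by simp only []; omega⟩
  refine ⟨fun k hk => ?_, fun k hk l hl h => ?_, fun v hv => ?_⟩
  · obtain ⟨i, rfl⟩ := hFin hk
    simp
  · obtain ⟨i, rfl⟩ := hFin hk
    obtain ⟨j, rfl⟩ := hFin hl
    simpa [Fin.val_inj] using h
  · obtain ⟨i, rfl⟩ := hFin hv
    exact ⟨σ.symm i + 1, by simp, by simp⟩

/-- The word `σ₁ ⋯ σ_N`. -/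
def word : List ℕ := (List.range' 1 N).map (entry σ)

theorem word_eq_map_finRange :
    word σ = ((List.finRange N).map σ).map (fun i : Fin N => (i : ℕ) + 1) :=
  List.ext_getElem (by simp [word]) fun i hi _ => by
    have hi : i < N := by simpa [word] using hi
    simpa [word, add_comm] using entry_add_one σ ⟨i, hi⟩

theorem word_injective : Function.Injective (word (N := N)) := by
  intro σ τ h
  rw [word_eq_map_finRange, word_eq_map_finRange] at h
  have hinj : Function.Injective fun i : Fin N => (i : ℕ) + 1 := fun i j hij => by
    simpa [Fin.val_inj] using hij
  ext i : 1
  simpa using List.map_inj_left.1 (hinj.list_map h) i (List.mem_finRange i)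

theorem word_perm : (word σ).Perm (List.range' 1 N) := by
  have hrange : List.range' 1 N = (List.finRange N).map (fun i : Fin N => (i : ℕ) + 1) :=
    List.ext_getElem (by simp) fun i _ _ => by simp [add_comm]
  rw [word_eq_map_finRange, hrange]
  exact (Equiv.Perm.map_finRange_perm σ).map _

theorem image_word : univ.image (word (N := N)) = (List.range' 1 N).permutations.toFinset := by
  refine eq_of_subset_of_card_le (fun w hw => ?_) ?_
  · obtain ⟨σ, -, rfl⟩ := mem_image.1 hw
    simpa using word_perm σ
  · rw [card_image_of_injective _ word_injective, card_univ, Fintype.card_perm, Fintype.card_fin]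
    simpa only [List.length_permutations, List.length_range'] using
      (List.range' 1 N).permutations.toFinset_card_le

/-- The number of descents on the left of the position `k` that straddle `σ_k`. -/
def lesAt (k : ℕ) : ℕ :=
  #{i ∈ range (k - 1) | entry σ (i + 1) < entry σ k ∧ entry σ k < entry σ i}

/-- The number of ascents on the right of the position `k` that straddle `σ_k`. -/
def resAscAt (k : ℕ) : ℕ :=
  #{j ∈ Ico (k + 1) N | entry σ j < entry σ k ∧ entry σ k < entry σ (j + 1)}

/-- The number of descents on the right of the position `k` that straddle `σ_k`. -/
def resDescAt (k : ℕ) : ℕ :=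
  #{j ∈ Ico (k + 1) N | entry σ (j + 1) < entry σ k ∧ entry σ k < entry σ j}

theorem les_eq_sum_lesAt : les σ = ∑ k ∈ Icc 1 N, lesAt σ k := by
  have h0 (i : ℕ) (hi : 0 < entry σ i) : i ≠ 0 := by rintro rfl; simp at hi
  simp only [les, lesAt, ← card_sigma]
  refine card_nbij' (fun x => ⟨x.2, x.1 - 1⟩) (fun x => (x.2 + 1, x.1)) ?_ ?_ ?_ ?_ <;>
  · intro x hx
    grind

theorem resAsc_eq_sum_resAscAt : resAsc σ = ∑ k ∈ Icc 1 N, resAscAt σ k := by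
  simp only [resAsc, resAscAt, ← card_sigma]
  refine card_nbij' (fun x => ⟨x.1, x.2⟩) (fun x => (x.1, x.2)) ?_ ?_ ?_ ?_ <;>
  · intro x hx
    grind

theorem resDesc_eq_sum_resDescAt : resDesc σ = ∑ k ∈ Icc 1 N, resDescAt σ k := by
  simp only [resDesc, resDescAt, ← card_sigma]
  refine card_nbij' (fun x => ⟨x.1, x.2⟩) (fun x => (x.1, x.2)) ?_ ?_ ?_ ?_ <;>
  · intro x hx
    grind

variable {σ} {k : ℕ}

theorem word_eq_append_cons (hk : k ∈ Icc 1 N) :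
    word σ = (List.range' 1 (k - 1)).map (entry σ) ++
      entry σ k :: (List.range' (k + 1) (N - k)).map (entry σ) := by
  rw [mem_Icc] at hk
  have hrange : List.range' 1 N = List.range' 1 (k - 1) ++ k :: List.range' (k + 1) (N - k) := by
    have := List.range'_append_1 (s := 1) (m := k - 1) (n := N - k + 1)
    rwa [(by omega : 1 + (k - 1) = k), (by omega : k - 1 + (N - k + 1) = N), List.range'_succ,
      eq_comm] at this
  rw [word, hrange, List.map_append, List.map_cons]

theorem entry_notMem_map {s : List ℕ} (hk : k ∈ Icc 1 N) (hks : k ∉ s)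
    (hs : ∀ i ∈ s, i ∈ Icc 1 N) : entry σ k ∉ s.map (entry σ) := by
  rw [List.mem_map]
  rintro ⟨i, hi, h⟩
  exact hks ((bijOn_entry σ).injOn (hs i hi) hk h ▸ hi)

theorem rightProfile_word (hk : k ∈ Icc 1 N) : rightProfile (entry σ k) (word σ) =
    (resAscAt σ k, decide (entry σ k < entry σ (k + 1))) := by
  have hN := mem_Icc.1 hk
  have hlast : k + 1 + (N - k) = N + 1 := by omega
  have hmem : entry σ k ∉ (List.range' 1 (k - 1)).map (entry σ) :=
    entry_notMem_map hk (by simp; omega) (by simp; omega)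
  have hfilter : {j ∈ Ico (k + 1) (N + 1) | entry σ j < entry σ k ∧ entry σ k < entry σ (j + 1)} =
      {j ∈ Ico (k + 1) N | entry σ j < entry σ k ∧ entry σ k < entry σ (j + 1)} := by
    grind [entry_of_lt]
  rw [rightProfile, word_eq_append_cons hk, suffixAfter_append_cons hmem,
    profile_map_range' (by simp [hlast, entry_of_lt]), hlast, hfilter, resAscAt]

theorem leftProfile_word (hk : k ∈ Icc 1 N) : leftProfile (entry σ k) (word σ) =
    (lesAt σ k, decide (entry σ k < entry σ (k - 1))) := by
  have hmem : entry σ k ∉ ((List.range' (k + 1) (N - k)).map (entry σ)).reverse := by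
    rw [List.mem_reverse]
    exact entry_notMem_map hk (by simp) (by simp; omega)
  rw [leftProfile, rightProfile, word_eq_append_cons hk, List.reverse_append, List.reverse_cons,
    List.append_assoc, List.singleton_append, suffixAfter_append_cons hmem,
    profile_reverse_map_range' (by simp), lesAt]

end PositionalStatistics

section EntryWeights

variable {N k : ℕ}

theorem card_filter_lt_add_toNat_eq {e : ℕ → ℕ} {u s t : ℕ} (hst : s ≤ t)
    (hu : ∀ j ∈ Icc s t, e j ≠ u) :
    #{j ∈ Ico s t | e j < u ∧ u < e (j + 1)} + (decide (e t < u)).toNat =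
      #{j ∈ Ico s t | e (j + 1) < u ∧ u < e j} + (decide (e s < u)).toNat := by
  induction t, hst using Nat.le_induction with
  | base => simp
  | succ t hst ih =>
    have ih := ih fun j hj => hu j (by grind)
    have ht := hu t (by grind)
    have ht' := hu (t + 1) (by grind)
    rw [← insert_Ico_right_eq_Ico_add_one hst, filter_insert, filter_insert, apply_ite card,
      apply_ite card, card_insert_of_notMem (by simp), card_insert_of_notMem (by simp)]
    rcases ht.lt_or_gt with ht | ht <;> rcases ht'.lt_or_gt with ht' | ht' <;>
      simp only [ht, ht', ht.not_gt, ht'.not_gt, decide_true, decide_false, Bool.toNat_true,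
        Bool.toNat_false, and_true, and_false, if_true, if_false, add_zero] at ih ⊢ <;> omega

variable (σ : Equiv.Perm (Fin N))

theorem entry_mem_Icc (hk : k ∈ Icc 1 N) : entry σ k ∈ Icc 1 N := (bijOn_entry σ).mapsTo hk

theorem entry_add_one_ne (hk : k ∈ Icc 1 N) : entry σ (k + 1) ≠ entry σ k := by
  intro h
  by_cases hk' : k + 1 ∈ Icc 1 N
  · exact k.succ_ne_self ((bijOn_entry σ).injOn hk' hk h)
  · have := entry_mem_Icc σ hk
    have := entry_of_lt σ (k := k + 1) (by grind)
    grind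

theorem isDescentTop_entry_iff (hk : k ∈ Icc 1 N) :
    IsDescentTop σ (entry σ k) ↔ IsDescentAt σ k := by
  refine ⟨fun ⟨i, hi, hdesc, h⟩ => ?_, fun h => ⟨k, h.1, h, rfl⟩⟩
  rwa [← (bijOn_entry σ).injOn (Ico_subset_Icc_self hi) hk h]

theorem isDescentBottom_entry_iff (hk : k ∈ Icc 1 N) :
    IsDescentBottom σ (entry σ k) ↔ entry σ k < entry σ (k - 1) := by
  constructor
  · rintro ⟨i, hi, hdesc, h⟩
    obtain rfl := (bijOn_entry σ).injOn (by grind) hk h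
    exact hdesc.2
  · intro h
    have hk0 : k - 1 ≠ 0 := fun h0 => by simp [h0] at h
    have hk1 : k - 1 + 1 = k := by omega
    have hmem : k - 1 ∈ Ico 1 N := by grind
    exact ⟨k - 1, hmem, ⟨hmem, by rwa [hk1]⟩, by rw [hk1]⟩

theorem snd_leftProfile_word (v : ℕ) :
    (leftProfile v (word σ)).2 = decide (IsDescentBottom σ v) := by
  by_cases hv : v ∈ Icc 1 N
  · obtain ⟨k, hk, rfl⟩ := (bijOn_entry σ).surjOn hv
    rw [leftProfile_word hk, decide_eq_decide, isDescentBottom_entry_iff σ hk]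
  · have hword : v ∉ word σ := fun h => hv <| by
      simpa [add_comm 1 N, Nat.lt_succ_iff] using (word_perm σ).mem_iff.1 h
    have hbot : ¬ IsDescentBottom σ v := by
      rintro ⟨i, hi, -, rfl⟩
      exact hv (entry_mem_Icc σ (by grind))
    rw [leftProfile, rightProfile, suffixAfter_of_notMem (by rwa [List.mem_reverse]), profile,
      decide_eq_false hbot]

theorem isLeftToRightMax_iff (hk : k ∈ Icc 1 N) :
    IsLeftToRightMax σ k ↔ lesAt σ k = 0 ∧ ¬ entry σ k < entry σ (k - 1) := by
  rw [lesAt, card_eq_zero, filter_eq_empty_iff]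
  constructor
  · intro h
    have hlt (i : ℕ) (hi : i < k) : ¬ entry σ k < entry σ i := by
      rcases i.eq_zero_or_pos with rfl | hpos
      · simp
      · exact (h i (by grind)).not_gt
    exact ⟨fun i hi hcross => hlt i (by grind) hcross.2, hlt (k - 1) (by grind)⟩
  · rintro ⟨hcross, hfall⟩ j hj
    have hne {i : ℕ} (hi : i ∈ Ico 1 k) : entry σ i ≠ entry σ k := fun h =>
      (mem_Ico.1 hi).2.ne ((bijOn_entry σ).injOn (by grind) hk h)
    by_contra hge
    have hlt (i : ℕ) (hji : j ≤ i) : i ≤ k - 1 → entry σ k < entry σ i := by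
      induction i, hji using Nat.le_induction with
      | base => exact fun _ => (hne hj).symm.lt_of_le (not_lt.1 hge)
      | succ i _ ih =>
        intro hi
        have := hcross (mem_range.2 hi)
        have := hne (i := i + 1) (by grind)
        grind
    exact hfall (hlt (k - 1) (by grind) le_rfl)

theorem des_eq_card : des σ = #{k ∈ Icc 1 N | entry σ k < entry σ (k - 1)} := by
  refine card_nbij' (· + 1) (· - 1) ?_ ?_ ?_ ?_
  · intro i hi
    grind [IsDescentAt]
  · intro k hk
    have hk0 : k - 1 ≠ 0 := fun h0 => by simp [h0] at hk
    grind [IsDescentAt]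
  · exact fun i _ => i.succ_sub_one
  · intro k hk
    grind

theorem prod_ite_one_eq_pow_card {ι M : Type*} [CommMonoid M] (s : Finset ι) (P : ι → Prop)
    [DecidablePred P] (x : M) : ∏ i ∈ s, (if P i then x else 1) = x ^ #{i ∈ s | P i} := by
  rw [← prod_filter, prod_const]

variable {R : Type*} [CommSemiring R] (f : ℕ → Bool → ℕ × Bool → ℕ × Bool → R)

/-- The weight `letterWeight` of the letter `σ_k` in the word of `σ`, in terms of positions. -/
def entryWeight (k : ℕ) : R :=
  f (entry σ k) (decide (IsDescentBottom σ (entry σ k - 1)))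
    (lesAt σ k, decide (entry σ k < entry σ (k - 1)))
    (resAscAt σ k, decide (entry σ k < entry σ (k + 1)))

theorem sum_perm_prod_entryWeight (hN : 0 < N) :
    ∑ σ : Equiv.Perm (Fin N), ∏ k ∈ Icc 1 N, entryWeight σ f k = transfer f N 0 false 1 := by
  rw [← sum_permutations_prod_letterWeight f hN, ← image_word,
    sum_image fun σ _ τ _ h => word_injective h]
  refine sum_congr rfl fun σ _ => prod_nbij (entry σ) (fun k hk => entry_mem_Icc σ hk)
    (bijOn_entry σ).injOn (bijOn_entry σ).surjOn fun k hk => ?_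
  rw [letterWeight, snd_leftProfile_word, leftProfile_word hk, rightProfile_word hk, entryWeight]

end EntryWeights

section OddOdd

variable {n : ℕ} {R : Type*} [CommSemiring R] (a p q y t : R)

theorem mem_oddOddPermsStar_iff {σ : Equiv.Perm (Fin (2 * n + 1))} :
    σ ∈ oddOddPermsStar n ↔ ∀ k ∈ Icc 1 (2 * n + 1), Even (entry σ k) →
      ¬ entry σ k < entry σ (k - 1) ∧ entry σ k < entry σ (k + 1) := by
  simp only [oddOddPermsStar, oddOddPerms, mem_filter, mem_univ, true_and]
  constructor
  · rintro ⟨hdesc, hlast⟩ k hk heven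
    have hodd := Nat.not_odd_iff_even.2 heven
    refine ⟨fun hfall => ?_, ?_⟩
    · have hk0 : k - 1 ≠ 0 := fun h0 => by simp [h0] at hfall
      have hk1 : k - 1 + 1 = k := by omega
      have hmem : k - 1 ∈ Ico 1 (2 * n + 1) := by grind
      have := (hdesc (k - 1) hmem ⟨hmem, by rwa [hk1]⟩).2
      exact hodd (by rwa [hk1] at this)
    · have hkN : k ≠ 2 * n + 1 := by rintro rfl; exact hodd hlast
      have hmem : k ∈ Ico 1 (2 * n + 1) := by grind
      refine (entry_add_one_ne σ hk).lt_or_gt.resolve_left fun hlt => ?_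
      exact hodd (hdesc k hmem ⟨hmem, hlt⟩).1
  · refine fun h => ⟨fun i hi hdesc => ⟨?_, ?_⟩, ?_⟩
    · by_contra hodd
      exact (h i (by grind) (Nat.not_odd_iff_even.1 hodd)).2.not_gt hdesc.2
    · by_contra hodd
      exact (h (i + 1) (by grind) (Nat.not_odd_iff_even.1 hodd)).1 hdesc.2
    · by_contra hodd
      have := (h (2 * n + 1) (by grind) (Nat.not_odd_iff_even.1 hodd)).2
      simp [entry_of_lt] at this

/-- The weight, in the generating polynomial `Y_n`, of the letter `v` with left profile `(i, b)` and
right profile `(j, c)`; it vanishes when an even letter is not followed by a larger letter, or is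
preceded by one. -/
def weightY (v : ℕ) (_ : Bool) : ℕ × Bool → ℕ × Bool → R
  | (i, b), (j, c) =>
    if Even v ∧ (b ∨ ¬ c) then 0
    else (if Even v ∧ i = 0 then a else 1) * p ^ j * q ^ i * (if b ∧ ¬ c then y else 1) *
      (if b then t else 1)

theorem entryWeight_weightY {k : ℕ} {σ : Equiv.Perm (Fin (2 * n + 1))}
    (hσ : σ ∈ oddOddPermsStar n) (hk : k ∈ Icc 1 (2 * n + 1)) :
    entryWeight σ (weightY a p q y t) k =
      (if IsLeftToRightMax σ k ∧ Even (entry σ k) then a else 1) * p ^ resAscAt σ k *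
        q ^ lesAt σ k *
        (if entry σ (k - 1) > entry σ k ∧ entry σ k > entry σ (k + 1) then y else 1) *
        (if entry σ k < entry σ (k - 1) then t else 1) := by
  have heven := mem_oddOddPermsStar_iff.1 hσ k hk
  have hrise : ¬ entry σ k < entry σ (k + 1) ↔ entry σ (k + 1) < entry σ k :=
    not_lt.trans (entry_add_one_ne σ hk).le_iff_lt
  have hmax : Even (entry σ k) ∧ lesAt σ k = 0 ↔ IsLeftToRightMax σ k ∧ Even (entry σ k) := by
    rw [isLeftToRightMax_iff σ hk]
    tauto
  have hne : ¬ (Even (entry σ k) ∧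
      (entry σ k < entry σ (k - 1) ∨ entry σ (k + 1) < entry σ k)) := by
    rw [← hrise]
    tauto
  simp only [entryWeight, weightY, decide_eq_true_eq, if_neg hne, hmax, hrise, gt_iff_lt]

theorem entryWeight_weightY_eq_zero {σ : Equiv.Perm (Fin (2 * n + 1))}
    (hσ : σ ∉ oddOddPermsStar n) :
    ∃ k ∈ Icc 1 (2 * n + 1), entryWeight σ (weightY a p q y t) k = 0 := by
  rw [mem_oddOddPermsStar_iff] at hσ
  push Not at hσ
  obtain ⟨k, hk, heven, h⟩ := hσ
  refine ⟨k, hk, if_pos ?_⟩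
  simp only [decide_eq_true_eq]
  exact ⟨heven, or_iff_not_imp_left.2 fun hfall => not_lt.2 (h (not_lt.1 hfall))⟩

theorem polyY_eq_transfer {S : Type*} [CommRing S] (a p q y t : S) :
    polyY n a p q y t = transfer (weightY a p q y t) (2 * n + 1) 0 false 1 := by
  rw [← sum_perm_prod_entryWeight _ (2 * n).succ_pos, polyY]
  refine sum_subset_zero_on_sdiff (subset_univ _) (fun σ hσ => ?_) fun σ hσ => ?_
  · obtain ⟨k, hk, h⟩ := entryWeight_weightY_eq_zero a p q y t (mem_sdiff.1 hσ).2
    exact prod_eq_zero hk h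
  · rw [prod_congr rfl fun k => entryWeight_weightY a p q y t hσ]
    simp only [prod_mul_distrib, prod_pow_eq_pow_sum, prod_ite_one_eq_pow_card, lema, dd,
      des_eq_card, resAsc_eq_sum_resAscAt, les_eq_sum_lesAt]

end OddOdd

section EvenOdd

section Extend

variable {N k : ℕ}

/-- The permutation `σ₁ ⋯ σ_N (N + 1)` of `[N + 1]`. -/
def extend (σ : Equiv.Perm (Fin N)) : Equiv.Perm (Fin (N + 1)) :=
  finSuccEquivLast.symm.permCongr σ.optionCongr

theorem extend_injective : Function.Injective (extend (N := N)) :=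
  (Equiv.injective _).comp Equiv.optionCongr_injective

theorem exists_extend_eq {τ : Equiv.Perm (Fin (N + 1))} (hτ : entry τ (N + 1) = N + 1) :
    ∃ σ, extend σ = τ := by
  have hlast : τ (Fin.last N) = Fin.last N := by
    have := entry_add_one τ (Fin.last N)
    simpa [hτ, Fin.ext_iff, eq_comm] using this
  obtain ⟨ρ, rfl⟩ := (finSuccEquivLast (n := N)).symm.permCongr.surjective τ
  have hnone : ρ none = none :=
    finSuccEquivLast.symm.injective (by simpa [Equiv.permCongr_apply] using hlast)
  refine ⟨Equiv.removeNone ρ, congrArg finSuccEquivLast.symm.permCongr ?_⟩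
  rw [map_equiv_removeNone, hnone, Equiv.swap_self, ← Equiv.Perm.one_def, one_mul]

variable (σ : Equiv.Perm (Fin N))

@[simp]
theorem entry_extend_last : entry (extend σ) (N + 1) = N + 1 := by
  simpa [extend] using entry_add_one (extend σ) (Fin.last N)

theorem entry_extend_of_le (hk : k ≤ N) : entry (extend σ) k = entry σ k := by
  rcases k.eq_zero_or_pos with rfl | hpos
  · simp
  · obtain ⟨i, rfl⟩ : ∃ i : Fin N, k = i + 1 :=
      ⟨⟨k - 1, by omega⟩, (Nat.sub_add_cancel hpos).symm⟩
    have := entry_add_one (extend σ) i.castSucc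
    rw [Fin.val_castSucc] at this
    rw [this, entry_add_one]
    simp [extend]

theorem lesAt_extend (hk : k ≤ N) : lesAt (extend σ) k = lesAt σ k := by
  rw [lesAt, lesAt, entry_extend_of_le σ hk]
  congr 1
  refine filter_congr fun i hi => ?_
  rw [mem_range] at hi
  rw [entry_extend_of_le σ (by omega), entry_extend_of_le σ (by omega)]

theorem isDescentAt_extend (i : ℕ) : IsDescentAt (extend σ) i ↔ IsDescentAt σ i := by
  rw [IsDescentAt, IsDescentAt, mem_Ico, mem_Ico]
  rcases lt_trichotomy i N with hi | rfl | hi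
  · rw [entry_extend_of_le σ hi.le, entry_extend_of_le σ hi]
    grind
  · by_cases hi : i ∈ Icc 1 i
    · have := entry_mem_Icc σ hi
      grind [entry_extend_of_le, entry_extend_last]
    · grind
  · grind

theorem isDescentBottom_extend (v : ℕ) : IsDescentBottom (extend σ) v ↔ IsDescentBottom σ v := by
  simp only [IsDescentBottom, isDescentAt_extend]
  refine exists_congr fun i => ⟨fun ⟨_, hdesc, h⟩ => ?_, fun ⟨_, hdesc, h⟩ => ?_⟩
  · rw [entry_extend_of_le σ (by grind [IsDescentAt])] at h
    exact ⟨hdesc.1, hdesc, h⟩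
  · rw [← entry_extend_of_le σ (by grind [IsDescentAt])] at h
    exact ⟨by grind, hdesc, h⟩

theorem not_lt_entry_extend_add_one_iff (hk : k ∈ Icc 1 N) :
    ¬ entry (extend σ) k < entry (extend σ) (k + 1) ↔ IsDescentAt σ k := by
  rw [← isDescentAt_extend, IsDescentAt, and_iff_right (by grind), not_lt]
  exact (entry_add_one_ne (extend σ) (by grind)).le_iff_lt

theorem resAscAt_extend (hk : k ∈ Icc 1 N) :
    resAscAt (extend σ) k = resDescAt σ k + (decide (IsDescentAt σ k)).toNat := by
  have hkN := mem_Icc.1 hk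
  have hek := mem_Icc.1 (entry_mem_Icc σ hk)
  have hne (j : ℕ) (hj : j ∈ Icc (k + 1) (N + 1)) :
      entry (extend σ) j ≠ entry (extend σ) k := fun h => by
    have := (bijOn_entry (extend σ)).injOn (by grind) (by grind) h
    grind
  have hasc := card_filter_lt_add_toNat_eq (by omega) hne
  have hlast : ¬ entry (extend σ) (N + 1) < entry (extend σ) k := by
    rw [entry_extend_last, entry_extend_of_le σ hkN.2]
    omega
  have hdesc : {j ∈ Ico (k + 1) (N + 1) | entry (extend σ) (j + 1) < entry (extend σ) k ∧
      entry (extend σ) k < entry (extend σ) j} =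
      {j ∈ Ico (k + 1) N | entry σ (j + 1) < entry σ k ∧ entry σ k < entry σ j} := by
    grind [entry_extend_of_le, entry_extend_last]
  have hnext : entry (extend σ) (k + 1) < entry (extend σ) k ↔ IsDescentAt σ k := by
    rw [← not_lt_entry_extend_add_one_iff σ hk, not_lt]
    exact (hne (k + 1) (by grind)).le_iff_lt.symm
  rw [decide_eq_false hlast, hdesc, decide_eq_decide.2 hnext] at hasc
  simpa only [resAscAt, resDescAt, Bool.toNat_false, add_zero] using hasc

theorem entryWeight_extend {R : Type*} [CommSemiring R]
    (f : ℕ → Bool → ℕ × Bool → ℕ × Bool → R) (hk : k ∈ Icc 1 N) :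
    entryWeight (extend σ) f k = f (entry σ k) (decide (IsDescentBottom σ (entry σ k - 1)))
      (lesAt σ k, decide (entry σ k < entry σ (k - 1)))
      (resDescAt σ k + (decide (IsDescentAt σ k)).toNat, !decide (IsDescentAt σ k)) := by
  have hkN := (mem_Icc.1 hk).2
  have hrise : entry (extend σ) k < entry (extend σ) (k + 1) ↔ ¬ IsDescentAt σ k := by
    rw [← not_lt_entry_extend_add_one_iff σ hk, not_not]
  rw [entryWeight, decide_eq_decide.2 hrise, decide_not]
  simp only [entry_extend_of_le σ hkN, entry_extend_of_le σ ((k.sub_le 1).trans hkN),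
    lesAt_extend σ hkN, resAscAt_extend σ hk, isDescentBottom_extend]

end Extend

variable {n : ℕ}

theorem mem_evenOddPerms_iff {σ : Equiv.Perm (Fin (2 * n))} :
    σ ∈ evenOddPerms n ↔ ∀ k ∈ Icc 1 (2 * n),
      ¬ (IsDescentAt σ k ∧ Odd (entry σ k) ∨ entry σ k < entry σ (k - 1) ∧ Even (entry σ k)) := by
  simp only [evenOddPerms, mem_filter, mem_univ, true_and]
  constructor
  · rintro h k hk (⟨hdesc, hodd⟩ | ⟨hfall, heven⟩)
    · exact Nat.not_even_iff_odd.2 hodd (h k hdesc.1 hdesc).1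
    · have hk0 : k - 1 ≠ 0 := fun h0 => by simp [h0] at hfall
      have hk1 : k - 1 + 1 = k := by omega
      have hmem : k - 1 ∈ Ico 1 (2 * n) := by grind
      have := (h (k - 1) hmem ⟨hmem, by rwa [hk1]⟩).2
      exact Nat.not_odd_iff_even.2 heven (by rwa [hk1] at this)
  · refine fun h i hi hdesc => ⟨?_, ?_⟩
    · by_contra heven
      exact h i (by grind) (.inl ⟨hdesc, Nat.not_even_iff_odd.1 heven⟩)
    · by_contra hodd
      exact h (i + 1) (by grind) (.inr ⟨hdesc.2, Nat.not_odd_iff_even.1 hodd⟩)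

theorem dom_eq_card (σ : Equiv.Perm (Fin (2 * n))) :
    dom σ = #{k ∈ Icc 1 (2 * n) |
      Even (entry σ k) ∧ IsDescentAt σ k ∧ IsDescentBottom σ (entry σ k - 1)} := by
  refine (card_nbij (fun k => entry σ k / 2) (fun k hk => ?_) (fun k hk l hl h => ?_)
    fun j hj => ?_).symm
  · obtain ⟨hk, ⟨j, hj⟩, hdesc, hbot⟩ := mem_filter.1 hk
    have := entry_mem_Icc σ hk
    have hj' : entry σ k / 2 = j := by omega
    rw [← isDescentTop_entry_iff σ hk] at hdesc
    rw [hj, ← two_mul] at hdesc hbot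
    refine mem_coe.2 (mem_filter.2 ?_)
    simp only [hj']
    exact ⟨by grind, hdesc, hbot⟩
  · exact (bijOn_entry σ).injOn (by grind) (by grind) (by grind)
  · obtain ⟨_, ⟨k, hk, hdesc, h⟩, hbot⟩ := mem_filter.1 hj
    refine ⟨k, mem_filter.2 ⟨by grind, ?_⟩, ?_⟩
    · exact ⟨by simp [h], hdesc, by rwa [h]⟩
    · simp [h]

variable {R : Type*} [CommSemiring R] (a p q y t : R)

/-- The weight, in the generating polynomial `X_n`, of the letter `v` with left profile `(i, b)` and
right profile `(j, c)` in a word on `1, …, 2n + 1` ending with `2n + 1`, where `d` tells whether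
`v - 1` is a descent bottom. In such a word the ascents straddling `v` on its right exceed the
descents straddling it by one if `v` is a descent top, and are equally many otherwise. The weight
vanishes when the word does not end with `2n + 1` or has a forbidden descent at `v`. -/
def weightX (n : ℕ) (v : ℕ) (d : Bool) : ℕ × Bool → ℕ × Bool → R
  | (i, b), (j, c) =>
    if v = 2 * n + 1 then 1
    else if ¬ c ∧ (Odd v ∨ j = 0) ∨ b ∧ Even v then 0
    else (if Even v ∧ i = 0 then a else 1) * p ^ (j - (!c).toNat) * q ^ i *
      (if Even v ∧ ¬ c ∧ d then y else 1) * (if b then t else 1)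

theorem entryWeight_weightX_extend {k : ℕ} (σ : Equiv.Perm (Fin (2 * n)))
    (hk : k ∈ Icc 1 (2 * n)) :
    entryWeight (extend σ) (weightX a p q y t n) k =
      if IsDescentAt σ k ∧ Odd (entry σ k) ∨ entry σ k < entry σ (k - 1) ∧ Even (entry σ k) then 0
      else (if IsLeftToRightMax σ k ∧ Even (entry σ k) then a else 1) * p ^ resDescAt σ k *
        q ^ lesAt σ k *
        (if Even (entry σ k) ∧ IsDescentAt σ k ∧ IsDescentBottom σ (entry σ k - 1) then y else 1) *
        (if entry σ k < entry σ (k - 1) then t else 1) := by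
  have hlt : entry σ k ≠ 2 * n + 1 := by
    have := mem_Icc.1 (entry_mem_Icc σ hk)
    omega
  have hmax := isLeftToRightMax_iff σ hk
  rw [entryWeight_extend σ _ hk, weightX, if_neg hlt]
  by_cases hdesc : IsDescentAt σ k <;> by_cases heven : Even (entry σ k) <;>
    by_cases hfall : entry σ k < entry σ (k - 1) <;>
    simp [hdesc, heven, hfall, hmax, ← Nat.not_even_iff_odd]

theorem entryWeight_weightX_extend_last (σ : Equiv.Perm (Fin (2 * n))) :
    entryWeight (extend σ) (weightX a p q y t n) (2 * n + 1) = 1 := by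
  rw [entryWeight, weightX, entry_extend_last, if_pos rfl]

theorem entryWeight_weightX_last_eq_zero {τ : Equiv.Perm (Fin (2 * n + 1))}
    (hτ : entry τ (2 * n + 1) ≠ 2 * n + 1) :
    entryWeight τ (weightX a p q y t n) (2 * n + 1) = 0 := by
  rw [entryWeight, weightX, if_neg hτ, if_pos]
  simp [entry_of_lt, resAscAt]

theorem polyX_eq_transfer {S : Type*} [CommRing S] (a p q y t : S) :
    polyX n a 1 1 1 p q y t = transfer (weightX a p q y t n) (2 * n + 1) 0 false 1 := by
  simp only [polyX, one_pow, mul_one]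
  rw [← sum_perm_prod_entryWeight _ (2 * n).succ_pos]
  have hinj : Set.InjOn extend (evenOddPerms n : Set (Equiv.Perm (Fin (2 * n)))) :=
    extend_injective.injOn
  refine sum_of_injOn extend hinj (fun _ _ => mem_coe.2 (mem_univ _)) (fun τ _ hτ => ?_)
    fun σ hσ => ?_
  · by_cases hlast : entry τ (2 * n + 1) = 2 * n + 1
    · obtain ⟨σ, rfl⟩ := exists_extend_eq hlast
      have hσ : σ ∉ evenOddPerms n := fun hσ => hτ ⟨σ, hσ, rfl⟩
      rw [mem_evenOddPerms_iff] at hσ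
      push Not at hσ
      obtain ⟨k, hk, h⟩ := hσ
      refine prod_eq_zero (i := k) (by grind) ?_
      rw [entryWeight_weightX_extend a p q y t σ hk, if_pos h]
    · exact prod_eq_zero (by simp) (entryWeight_weightX_last_eq_zero a p q y t hlast)
  · rw [prod_Icc_succ_top (by omega), entryWeight_weightX_extend_last, mul_one,
      prod_congr rfl fun k hk => (entryWeight_weightX_extend a p q y t σ hk).trans
        (if_neg (mem_evenOddPerms_iff.1 hσ k hk))]
    simp only [prod_mul_distrib, prod_pow_eq_pow_sum, prod_ite_one_eq_pow_card, lema, dom_eq_card,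
      des_eq_card, resDesc_eq_sum_resDescAt, les_eq_sum_lesAt]

end EvenOdd

section Comparison

variable {n : ℕ} {R : Type*} [CommSemiring R] (a p q y t : R)

/-- The weighted number of ways to choose one of `K` gaps, with weight `q` for each gap to its left
and `p` for each gap to its right, and an additional weight `a` for the first gap; this is the
`(p, q)`-analogue of the number `a + K - 1`. -/
def pqNumber (K : ℕ) : R := ∑ i ∈ range K, (if i = 0 then a else 1) * p ^ (K - 1 - i) * q ^ i

theorem transfer_weightY_of_odd {v : ℕ} (hv : Odd (v + 1)) (m : ℕ) (d : Bool) (K : ℕ) :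
    transfer (weightY a p q y t) (m + 1) v d K = pqNumber 1 p q K *
      (transfer (weightY a p q y t) m (v + 1) false (K - 1) +
        transfer (weightY a p q y t) m (v + 1) false K +
        t * y * transfer (weightY a p q y t) m (v + 1) true K +
        t * transfer (weightY a p q y t) m (v + 1) true (K + 1)) := by
  obtain _ | K := K
  · simp [transfer, pqNumber]
  rw [transfer, pqNumber, sum_mul]
  refine sum_congr rfl fun i _ => ?_
  simp only [weightY, Nat.not_even_iff_odd.2 hv, Fintype.sum_bool, false_and, and_true, and_false,
    not_true_eq_false, Bool.false_eq_true, not_false_eq_true, if_true, if_false, ite_self,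
    Bool.toNat_true, Bool.toNat_false, add_zero, Nat.add_sub_cancel]
  ring

theorem transfer_weightY_of_even {v : ℕ} (hv : Even (v + 1)) (m : ℕ) (d : Bool) (K : ℕ) :
    transfer (weightY a p q y t) (m + 1) v d K =
      pqNumber a p q K * transfer (weightY a p q y t) m (v + 1) false K := by
  obtain _ | K := K
  · simp [transfer, pqNumber]
  rw [transfer, pqNumber, sum_mul]
  refine sum_congr rfl fun i _ => ?_
  simp [weightY, hv]

theorem transfer_weightX_of_odd {v : ℕ} (hv : Odd (v + 1)) (hvn : v ≠ 2 * n) (m : ℕ)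
    (d : Bool) (K : ℕ) :
    transfer (weightX a p q y t n) (m + 1) v d K = pqNumber 1 p q K *
      (transfer (weightX a p q y t n) m (v + 1) false K +
        t * transfer (weightX a p q y t n) m (v + 1) true (K + 1)) := by
  obtain _ | K := K
  · simp [transfer, pqNumber]
  rw [transfer, pqNumber, sum_mul]
  refine sum_congr rfl fun i _ => ?_
  simp only [weightX, Nat.add_right_cancel_iff, hvn, hv, Nat.not_even_iff_odd.2 hv,
    Fintype.sum_bool, true_or, false_and, and_true, and_false, or_false, not_true_eq_false,
    Bool.false_eq_true, not_false_eq_true, Bool.not_true, if_true, if_false, ite_self,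
    Bool.toNat_true, Bool.toNat_false, add_zero, Nat.add_sub_cancel, Nat.sub_zero]
  ring

theorem transfer_weightX_of_even {v : ℕ} (hv : Even (v + 1)) (m : ℕ) (d : Bool) (K : ℕ) :
    transfer (weightX a p q y t n) (m + 1) v d K =
      pqNumber a p q K * transfer (weightX a p q y t n) m (v + 1) false K +
        pqNumber a p q (K - 1) *
          ((if d then y else 1) * transfer (weightX a p q y t n) m (v + 1) false (K - 1)) := by
  obtain _ | K := K
  · simp [transfer, pqNumber]
  have hvn : v ≠ 2 * n := by grind
  have hpred : pqNumber a p q K = ∑ i ∈ range (K + 1),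
      if K - i = 0 then 0 else (if i = 0 then a else 1) * p ^ (K - i - 1) * q ^ i := by
    rw [pqNumber, sum_range_succ, if_pos (Nat.sub_self K), add_zero]
    refine sum_congr rfl fun i hi => ?_
    rw [if_neg (by grind : K - i ≠ 0), Nat.sub_right_comm]
  rw [transfer, Nat.add_sub_cancel, hpred, pqNumber, sum_mul, sum_mul, ← sum_add_distrib]
  refine sum_congr rfl fun i _ => ?_
  simp only [weightX, Nat.add_right_cancel_iff, hvn, hv, Nat.not_odd_iff_even.2 hv,
    Fintype.sum_bool, false_or, or_true, or_false, true_and, false_and, and_true,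
    not_true_eq_false, Bool.false_eq_true, not_false_eq_true, Bool.not_true, Bool.not_false,
    if_true, if_false, Bool.toNat_true, Bool.toNat_false, add_zero, Nat.add_sub_cancel,
    Nat.sub_zero]
  split_ifs <;> ring

theorem transfer_weightX_eq_transfer_weightY {k v : ℕ} (hv : v + 2 * k = 2 * n) (d d' : Bool)
    (K : ℕ) : transfer (weightX a p q y t n) (2 * k + 1) v d K =
      transfer (weightY a p q y t) (2 * k + 1) v d' K := by
  induction k generalizing v d d' K with
  | zero =>
    obtain rfl : v = 2 * n := hv
    obtain _ | _ | K := K <;> simp [transfer, weightX, weightY, -sum_boole]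
  | succ k ih =>
    have hodd : Odd (v + 1) := by grind
    have heven : Even (v + 1 + 1) := by grind
    have hv2 : v + 1 + 1 + 2 * k = 2 * n := by omega
    rw [mul_add, mul_one, add_right_comm, transfer_weightX_of_odd a p q y t hodd (by omega),
      transfer_weightY_of_odd a p q y t hodd]
    simp only [transfer_weightX_of_even a p q y t heven, transfer_weightY_of_even a p q y t heven,
      ih hv2 false false, Nat.add_sub_cancel, if_true, Bool.false_eq_true, if_false]
    ring

end Comparison

end Genocchi

theorem mainTheorem5 {R : Type*} [CommRing R] (n : ℕ) (hn : 1 ≤ n) (a p q y t : R) :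
    Genocchi.polyY n a p q y t = Genocchi.polyX n a 1 1 1 p q y t := by
  rw [Genocchi.polyX_eq_transfer, Genocchi.polyY_eq_transfer,
    Genocchi.transfer_weightX_eq_transfer_weightY a p q y t (zero_add _) false false]
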